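/- Write $\pi_0,\pi_1$ for projections, $\langle f,g\rangle$ for pairing, $*$ for the terminal object, $!$ for maps to $*$. A \emph{Cartesian left-additive category} is a category $\mathcal C$ with (chosen) finite products whose hom-sets are commutative monoids $(+,0)$ such that $(f+g)\circ h=f\circ h+g\circ h$, $0\circ h=0$, $\pi_i\circ(f+g)=\pi_i\circ f+\pi_i\circ g$ and $\pi_i\circ 0=0$. A \emph{Cartesian reverse derivative category} (CRDC) is a Cartesian left-additive category with a combinator taking $f\colon X\to Y$ to $\mathbf R[f]\colon X\times Y\to X$ and satisfying, with $\mathbf D[f]:=\pi_1\circ\mathbf R[\mathbf R[f]]\circ(\langle\mathrm{id},0\rangle\times\mathrm{id})\colon X\times X\to Y$, \begin{itemize} \item RD.1: $\mathbf R[f+g]=\mathbf R[f]+\mathbf R[g]$, $\mathbf R[0]=0$; \item RD.2: $\mathbf R[f]\circ\langle a,b+c\rangle=\mathbf R[f]\circ\langle a,b\rangle+\mathbf R[f]\circ\langle a,c\rangle$, $\mathbf R[f]\circ\langle a,0\rangle=0$; \item RD.3: $\mathbf R[\mathrm{id}]=\pi_1$, $\mathbf R[\pi_0]=\langle\mathrm{id},0\rangle\circ\pi_1$,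 $\mathbf R[\pi_1]=\langle 0,\mathrm{id}\rangle\circ\pi_1$; \item RD.4: $\mathbf R[\langle f,g\rangle]=\mathbf R[f]\circ(\mathrm{id}\times\pi_0)+\mathbf R[g]\circ(\mathrm{id}\times\pi_1)$, $\mathbf R[!]=0$; \item RD.5: $\mathbf R[g\circ f]=\mathbf R[f]\circ(\mathrm{id}\times\mathbf R[g])\circ\langle\pi_0,\langle f\circ\pi_0,\pi_1\rangle\rangle$; \item RD.6: $\mathbf D[\mathbf R[f]]\circ\langle\mathrm{id}\times\pi_0,0\times\pi_1\rangle=\mathbf R[f]\circ(\mathrm{id}\times\pi_1)$; \item RD.7: $\mathbf D[\mathbf D[f]]\circ\langle\pi_0\times\pi_0,\pi_1\times\pi_1\rangle=\mathbf D[\mathbf D[f]]$. \end{itemize} A map $f$ is \emph{linear} if $\mathbf D[f]=f\circ\pi_1$; $\mathsf{Lin}(\mathcal C)$ is the category with the objects of $\mathcal C$ and the linear maps, whose finite products are those of $\mathcal C$. For a linear $\phi\colon X\to Y$ put $\phi^\dag:=\mathbf R[\phi]\circ\langle 0,\mathrm{id}\rangle\colon Y\to X$. For $v\colon Y\to Y$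 in $\mathcal C$ put $D(\phi)(v):=\phi^\dag\circ v\circ\phi$, and for $v\colon X\to X$, $w\colon Y\to Y$ put $\varphi_{X,Y}(v,w):=\pi_0^\dag\circ v\circ\pi_0+\pi_1^\dag\circ w\circ\pi_1\colon X\times Y\to X\times Y$. The \emph{identity decoration} on $N$ is $D(!)(\mathrm{id}_*)\colon N\to N$. An \emph{open dynamical system} from $X$ to $Y$ is a span $X\xleftarrow{l}N\xrightarrow{r}Y$ in $\mathsf{Lin}(\mathcal C)$ with a map $v\colon N\to N$ in $\mathcal C$. Two such, $(N,l,r,v)$ and $(N',l',r',v')$, are isomorphic if there is an isomorphism $\theta\colon N\to N'$ in $\mathsf{Lin}(\mathcal C)$ with $l'\theta=l$, $r'\theta=r$ and $D(\theta)(v')=v$. A \emph{hypergraph category} is a symmetric monoidal category in which each object $X$ carries a commutative monoid $(\mu_X,\eta_X)$ and a cocommutative comonoid $(\delta_X,\epsilon_X)$ that satisfy the Frobenius law and $\mu_X\circ\delta_X=\mathrm{id}$, such that the structure on $X\otimes Y$ is the one induced by those on $X$ and $Y$, and the structure on the monoidal unit is the canonical one. \textbf{Corollary (Open Generalized Dynamics).}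 Let $\mathcal C$ be a CRDC such that $\mathsf{Lin}(\mathcal C)$ has finite limits. Then the following data are well defined and form a hypergraph category $\mathbf{Dynam}_{\mathcal C}$. \begin{itemize} \item Objects are those of $\mathcal C$; morphisms $X\to Y$ are isomorphism classes of open dynamical systems from $X$ to $Y$. \item The composite of the classes of $(X\xleftarrow{l_1}N\xrightarrow{r_1}Y,\,v)$ and $(Y\xleftarrow{l_2}M\xrightarrow{r_2}Z,\,w)$ is, for any pullback $N\xleftarrow{b_0}N\times_YM\xrightarrow{b_1}M$ of $r_1,l_2$ in $\mathsf{Lin}(\mathcal C)$, the class of the span $X\xleftarrow{l_1b_0}N\times_YM\xrightarrow{r_2b_1}Z$ with the system $D(\langle b_0,b_1\rangle)(\varphi_{N,M}(v,w))$. \item The identity on $X$ is the class of $X=X=X$ with the identity decoration. \item The monoidal product on objects is their product in $\mathcal C$, with unit $*$; the product of the classes of $(X\leftarrow N\to Y,\,v)$ and $(W\leftarrow M\to Z,\,w)$ is the class of $(X\times W\leftarrow N\times M\to Y\times Z,\,\varphi_{N,M}(v,w))$. \item The associators, unitors and braidings are the classes of the spans $A=A\xrightarrow{c}B$, where $c$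 is the corresponding structure map for products in $\mathsf{Lin}(\mathcal C)$, with the identity decoration. \item The Frobenius maps $\mu_X,\eta_X,\delta_X,\epsilon_X$ are the classes of the spans $X\times X\xleftarrow{\Delta}X=X$, $\;*\xleftarrow{!}X=X$, $\;X=X\xrightarrow{\Delta}X\times X$, $\;X=X\xrightarrow{!}*$ with the identity decoration, where $\Delta=\langle\mathrm{id},\mathrm{id}\rangle$. \end{itemize} -/

import Mathlib

open CategoryTheory Limits MonoidalCategory CartesianMonoidalCategory

universe v u w

/-! ### Cartesian reverse derivative categories

Composition is written in diagrammatic order, `X ⊗ Y` is the product of `X` and `Y`,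
`𝟙_ C` is the terminal object, `lift f g` is the pairing of `f` and `g`. -/

/-- A Cartesian left-additive category: every hom-set is a commutative monoid, precomposition with
any morphism is additive, and postcomposition with the projections is additive. -/
class CartesianLeftAdditive (C : Type u) [Category.{v} C] [CartesianMonoidalCategory C] where
  homMonoid (X Y : C) : AddCommMonoid (X ⟶ Y)
  precomp_add {X Y Z : C} (h : X ⟶ Y) (f g : Y ⟶ Z) : h ≫ (f + g) = h ≫ f + h ≫ g
  precomp_zero {X Y Z : C} (h : X ⟶ Y) : h ≫ (0 : Y ⟶ Z) = 0
  add_fst {X Y Z : C} (f g : X ⟶ Y ⊗ Z) : (f + g) ≫ fst Y Z = f ≫ fst Y Z + g ≫ fst Y Z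
  add_snd {X Y Z : C} (f g : X ⟶ Y ⊗ Z) : (f + g) ≫ snd Y Z = f ≫ snd Y Z + g ≫ snd Y Z
  zero_fst {X Y Z : C} : (0 : X ⟶ Y ⊗ Z) ≫ fst Y Z = 0
  zero_snd {X Y Z : C} : (0 : X ⟶ Y ⊗ Z) ≫ snd Y Z = 0

attribute [reducible, instance] CartesianLeftAdditive.homMonoid

/-- The forward derivative `D[f] = π₁ ∘ R[R[f]] ∘ (⟨id, 0⟩ × id) : X × X → Y` obtained from a reverse
derivative combinator `R`. -/
def forwardOf {C : Type u} [Category.{v} C] [CartesianMonoidalCategory C] [CartesianLeftAdditive C]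
    (R : ∀ {X Y : C}, (X ⟶ Y) → (X ⊗ Y ⟶ X)) {X Y : C} (f : X ⟶ Y) : X ⊗ X ⟶ Y :=
  (lift (𝟙 X) (0 : X ⟶ Y) ⊗ₘ 𝟙 X) ≫ R (R f) ≫ snd X Y

/-- A Cartesian reverse derivative category: a Cartesian left-additive category with a combinator
`R` satisfying the axioms RD.1 to RD.7 of Cockett et al. -/
class CartesianReverseDerivative (C : Type u) [Category.{v} C] [CartesianMonoidalCategory C]
    extends CartesianLeftAdditive C where
  /-- the reverse derivative `R[f] : X × Y → X` of `f : X → Y` -/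
  R {X Y : C} (f : X ⟶ Y) : X ⊗ Y ⟶ X
  /-- RD.1 -/
  R_add {X Y : C} (f g : X ⟶ Y) : R (f + g) = R f + R g
  R_zero {X Y : C} : R (0 : X ⟶ Y) = 0
  /-- RD.2 -/
  lift_add_R {X Y Z : C} (f : X ⟶ Y) (a : Z ⟶ X) (b c : Z ⟶ Y) :
    lift a (b + c) ≫ R f = lift a b ≫ R f + lift a c ≫ R f
  lift_zero_R {X Y Z : C} (f : X ⟶ Y) (a : Z ⟶ X) : lift a (0 : Z ⟶ Y) ≫ R f = 0
  /-- RD.3 -/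
  R_id (X : C) : R (𝟙 X) = snd X X
  R_fst (X Y : C) : R (fst X Y) = snd (X ⊗ Y) X ≫ lift (𝟙 X) 0
  R_snd (X Y : C) : R (snd X Y) = snd (X ⊗ Y) Y ≫ lift 0 (𝟙 Y)
  /-- RD.4 -/
  R_lift {X Y Z : C} (f : X ⟶ Y) (g : X ⟶ Z) :
    R (lift f g) = (𝟙 X ⊗ₘ fst Y Z) ≫ R f + (𝟙 X ⊗ₘ snd Y Z) ≫ R g
  R_toUnit (X : C) : R (toUnit X) = 0
  /-- RD.5 -/
  R_comp {X Y Z : C} (f : X ⟶ Y) (g : Y ⟶ Z) :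
    R (f ≫ g) = lift (fst X Z) (lift (fst X Z ≫ f) (snd X Z)) ≫ (𝟙 X ⊗ₘ R g) ≫ R f
  /-- RD.6 -/
  forward_R {X Y : C} (f : X ⟶ Y) :
    lift (𝟙 X ⊗ₘ fst Y Y) ((0 : X ⟶ X) ⊗ₘ snd Y Y) ≫ forwardOf R (R f) =
      (𝟙 X ⊗ₘ snd Y Y) ≫ R f
  /-- RD.7 -/
  forward_forward {X Y : C} (f : X ⟶ Y) :
    lift (fst X X ⊗ₘ fst X X) (snd X X ⊗ₘ snd X X) ≫ forwardOf R (forwardOf R f) =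
      forwardOf R (forwardOf R f)

namespace Dynamics

open CartesianLeftAdditive CartesianReverseDerivative

section

variable {C : Type u} [Category.{v} C] [CartesianMonoidalCategory C] [CartesianReverseDerivative C]

/-- The derivative combinator `D[f] : X × X → Y` of a Cartesian reverse derivative category. -/
def D {X Y : C} (f : X ⟶ Y) : X ⊗ X ⟶ Y := forwardOf R f

variable (C) in
/-- Linear maps: `D[f] = f ∘ π₁`. -/
def linear : MorphismProperty C := fun X _ f => D f = snd X X ≫ f

lemma lift_add_lift {T X Y : C} (a a' : T ⟶ X) (b b' : T ⟶ Y) :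
    lift a b + lift a' b' = lift (a + a') (b + b') := by
  ext <;> simp [add_fst, add_snd]

lemma lift_zero_zero {T X Y : C} : lift (0 : T ⟶ X) (0 : T ⟶ Y) = 0 := by
  ext <;> simp [zero_fst, zero_snd]

lemma lift_R_comp {T X Y Z : C} (a : T ⟶ X) (b : T ⟶ Z) (f : X ⟶ Y) (g : Y ⟶ Z) :
    lift a b ≫ R (f ≫ g) = lift a (lift (a ≫ f) b ≫ R g) ≫ R f := by
  rw [R_comp]; simp only [← Category.assoc]; simp

lemma lift_R_lift {T X Y Z : C} (a : T ⟶ X) (b : T ⟶ Y) (c : T ⟶ Z) (f : X ⟶ Y) (g : X ⟶ Z) :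
    lift a (lift b c) ≫ R (lift f g) = lift a b ≫ R f + lift a c ≫ R g := by
  rw [R_lift, precomp_add]; simp

lemma lift_D {T X Y : C} (a b : T ⟶ X) (f : X ⟶ Y) :
    lift a b ≫ D f = lift (lift a 0) b ≫ R (R f) ≫ snd X Y := by
  simp [D, forwardOf, precomp_zero]

lemma D_ext {X Y : C} {f : X ⟶ Y} {g : X ⊗ X ⟶ Y}
    (h : lift (fst X X) (snd X X) ≫ D f = lift (fst X X) (snd X X) ≫ g) : D f = g := by
  simpa using h

lemma lift_R_fst {T X Y : C} (a : T ⟶ X ⊗ Y) (b : T ⟶ X) :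
    lift a b ≫ R (fst X Y) = lift b 0 := by
  simp [R_fst, precomp_zero]

lemma lift_R_snd {T X Y : C} (a : T ⟶ X ⊗ Y) (b : T ⟶ Y) :
    lift a b ≫ R (snd X Y) = lift 0 b := by
  simp [R_snd, precomp_zero]

/-- The reverse derivative of `h ∘ π₀`. -/
lemma lift_R_fst_comp {T X Y Z : C} (a : T ⟶ X ⊗ Y) (b : T ⟶ Z) (h : X ⟶ Z) :
    lift a b ≫ R (fst X Y ≫ h) = lift (lift (a ≫ fst X Y) b ≫ R h) 0 := by
  rw [lift_R_comp, lift_R_fst]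

lemma lift_R_snd_comp {T X Y Z : C} (a : T ⟶ X ⊗ Y) (b : T ⟶ Z) (h : Y ⟶ Z) :
    lift a b ≫ R (snd X Y ≫ h) = lift 0 (lift (a ≫ snd X Y) b ≫ R h) := by
  rw [lift_R_comp, lift_R_snd]

/-- The chain rule for the forward derivative. -/
lemma lift_D_comp {T X Y Z : C} (a b : T ⟶ X) (f : X ⟶ Y) (g : Y ⟶ Z) :
    lift a b ≫ D (f ≫ g) = lift (a ≫ f) (lift a b ≫ D f) ≫ D g := by
  rw [lift_D, lift_D, lift_D]
  have e : R (f ≫ g) =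
      lift (fst X Z) (lift (fst X Z ≫ f) (snd X Z) ≫ R g) ≫ R f := by
    rw [R_comp]; simp
  have e1 : lift a (0 : T ⟶ Z) ≫ lift (fst X Z) (lift (fst X Z ≫ f) (snd X Z) ≫ R g) =
      lift a 0 := by
    simp only [comp_lift, lift_fst]
    rw [← Category.assoc, comp_lift, lift_snd, lift_zero_R]
  have e2 : lift a (0 : T ⟶ Z) ≫ lift (fst X Z ≫ f) (snd X Z) = lift (a ≫ f) 0 := by simp
  conv_lhs => rw [e, ← Category.assoc, lift_R_comp, e1]
  set q := lift (lift a (0 : T ⟶ Y)) b ≫ R (R f) with hq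
  rw [show q = lift (q ≫ fst X Y) (q ≫ snd X Y) by simp, lift_R_lift, add_snd, lift_R_fst, lift_snd,
    zero_add, lift_R_comp, e2]
  set p := lift (lift (a ≫ f) (0 : T ⟶ Z)) (q ≫ snd X Y) ≫ R (R g) with hp
  rw [show p = lift (p ≫ fst Y Z) (p ≫ snd Y Z) by simp, lift_R_lift, add_snd, lift_R_fst_comp,
    lift_R_snd, lift_snd, lift_snd, zero_add]
  rw [hp, hq]; simp

lemma D_id (X : C) : D (𝟙 X) = snd X X := by
  apply D_ext
  rw [lift_D, R_id, ← Category.assoc, lift_R_snd]; simp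

lemma D_fst (X Y : C) : D (fst X Y) = snd _ _ ≫ fst X Y := by
  apply D_ext
  rw [lift_D, R_fst, ← Category.assoc, lift_R_snd_comp, lift_snd, R_lift, precomp_add]
  simp only [lift_map_assoc]
  simp [R_id, R_zero, precomp_zero]

lemma D_snd (X Y : C) : D (snd X Y) = snd _ _ ≫ snd X Y := by
  apply D_ext
  rw [lift_D, R_snd, ← Category.assoc, lift_R_snd_comp, lift_snd, R_lift, precomp_add]
  simp only [lift_map_assoc]
  simp [R_id, R_zero, precomp_zero]

lemma lift_D_lift {T X Y Z : C} (a b : T ⟶ X) (f : X ⟶ Y) (g : X ⟶ Z) :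
    lift a b ≫ D (lift f g) = lift (lift a b ≫ D f) (lift a b ≫ D g) := by
  ext
  · have h := lift_D_comp a b (lift f g) (fst Y Z)
    rw [D_fst] at h; simpa using h.symm
  · have h := lift_D_comp a b (lift f g) (snd Y Z)
    rw [D_snd] at h; simpa using h.symm

lemma linear_apply {T X Y : C} {f : X ⟶ Y} (hf : linear C f) (a b : T ⟶ X) :
    lift a b ≫ D f = b ≫ f := by
  rw [show D f = _ from hf]; simp

lemma linear_of {X Y : C} {f : X ⟶ Y}
    (h : lift (fst X X) (snd X X) ≫ D f = snd X X ≫ f) : linear C f := by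
  rw [lift_fst_snd, Category.id_comp] at h
  exact h

lemma linear_fst (X Y : C) : linear C (fst X Y) := D_fst X Y

lemma linear_snd (X Y : C) : linear C (snd X Y) := D_snd X Y

lemma linear_toUnit (X : C) : linear C (toUnit X) := toUnit_unique _ _

lemma linear_comp {X Y Z : C} {f : X ⟶ Y} {g : Y ⟶ Z} (hf : linear C f) (hg : linear C g) :
    linear C (f ≫ g) :=
  linear_of (by rw [lift_D_comp, linear_apply hg, linear_apply hf, Category.assoc])

lemma linear_lift {X Y Z : C} {f : X ⟶ Y} {g : X ⟶ Z} (hf : linear C f) (hg : linear C g) :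
    linear C (lift f g) :=
  linear_of (by rw [lift_D_lift, linear_apply hg, linear_apply hf, comp_lift])

lemma linear_id (X : C) : linear C (𝟙 X) := by
  rw [linear, D_id, Category.comp_id]

/-- Linear maps preserve zero. -/
lemma zero_comp_linear {T X Y : C} {f : X ⟶ Y} (hf : linear C f) : (0 : T ⟶ X) ≫ f = 0 := by
  rw [← linear_apply hf 0 0, lift_D, ← Category.assoc, lift_zero_R, zero_snd]

instance : (linear C).IsMultiplicative where
  id_mem := linear_id
  comp_mem _ _ := linear_comp

lemma linear_tensorHom {X X' Y Y' : C} {f : X ⟶ Y} {g : X' ⟶ Y'} (hf : linear C f)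
    (hg : linear C g) : linear C (f ⊗ₘ g) := by
  rw [← lift_fst_comp_snd_comp]
  exact linear_lift (linear_comp (linear_fst _ _) hf) (linear_comp (linear_snd _ _) hg)

instance : (linear C).IsMonoidalStable where
  whiskerLeft X _ _ f hf := by
    rw [← id_tensorHom]; exact linear_tensorHom (linear_id _) hf
  whiskerRight f hf X := by
    rw [← tensorHom_id]; exact linear_tensorHom hf (linear_id _)
  associator_hom_mem X Y Z := by
    have h : (α_ X Y Z).hom = lift (fst _ _ ≫ fst _ _) (lift (fst _ _ ≫ snd _ _) (snd _ _)) := by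
      ext <;> simp
    rw [h]
    exact linear_lift (linear_comp (linear_fst _ _) (linear_fst _ _))
      (linear_lift (linear_comp (linear_fst _ _) (linear_snd _ _)) (linear_snd _ _))
  associator_inv_mem X Y Z := by
    have h : (α_ X Y Z).inv = lift (lift (fst _ _) (snd _ _ ≫ fst _ _)) (snd _ _ ≫ snd _ _) := by
      ext <;> simp
    rw [h]
    exact linear_lift (linear_lift (linear_fst _ _) (linear_comp (linear_snd _ _) (linear_fst _ _)))
      (linear_comp (linear_snd _ _) (linear_snd _ _))
  leftUnitor_hom_mem X := by rw [leftUnitor_hom]; exact linear_snd _ _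
  leftUnitor_inv_mem X := by
    rw [show (λ_ X).inv = lift (toUnit X) (𝟙 X) by ext; simp]
    exact linear_lift (linear_toUnit _) (linear_id _)
  rightUnitor_hom_mem X := by rw [rightUnitor_hom]; exact linear_fst _ _
  rightUnitor_inv_mem X := by
    rw [show (ρ_ X).inv = lift (𝟙 X) (toUnit X) by ext; simp]
    exact linear_lift (linear_id _) (linear_toUnit _)

end

/-- The category `Lin(C)`: all objects of `C`, with the linear maps as morphisms. -/
abbrev Lin (C : Type u) [Category.{v} C] [CartesianMonoidalCategory C]
    [CartesianReverseDerivative C] : Type u :=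
  WideSubcategory (linear C)

variable {C : Type u} [Category.{v} C] [CartesianMonoidalCategory C] [CartesianReverseDerivative C]

/-- The products of `C` are products in `Lin(C)`, as projections and pairings are linear. -/
instance : CartesianMonoidalCategory (Lin C) where
  toMonoidalCategory := inferInstance
  isTerminalTensorUnit := IsTerminal.ofUniqueHom (fun X => ⟨toUnit X.obj, linear_toUnit _⟩)
    (fun _ _ => WideSubcategory.hom_ext _ (toUnit_unique _ _))
  fst X Y := ⟨fst X.obj Y.obj, linear_fst _ _⟩
  snd X Y := ⟨snd X.obj Y.obj, linear_snd _ _⟩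
  fst_def _ _ := WideSubcategory.hom_ext _ (fst_def _ _)
  snd_def _ _ := WideSubcategory.hom_ext _ (snd_def _ _)
  tensorProductIsBinaryProduct _ _ := BinaryFan.IsLimit.mk _
    (fun f g => ⟨lift f.hom g.hom, linear_lift f.property g.property⟩)
    (fun _ _ => WideSubcategory.hom_ext _ (lift_fst _ _))
    (fun _ _ => WideSubcategory.hom_ext _ (lift_snd _ _))
    (fun _ _ _ h₁ h₂ => WideSubcategory.hom_ext _ (CartesianMonoidalCategory.hom_ext _ _
      ((congrArg (fun k => k.hom) h₁).trans (lift_fst _ _).symm)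
      ((congrArg (fun k => k.hom) h₂).trans (lift_snd _ _).symm)))

instance : BraidedCategory (Lin C) := .ofCartesianMonoidalCategory

/-! ### The decorating functor -/

/-- The dagger of a linear map; it is determined by `R[φ] = φ† ∘ π₁`, so `φ† = R[φ] ∘ ⟨0, id⟩`. -/
def dagger {X Y : Lin C} (φ : X ⟶ Y) : Y.obj ⟶ X.obj :=
  lift (0 : Y.obj ⟶ X.obj) (𝟙 Y.obj) ≫ R φ.hom

/-- The action `v ↦ φ† ∘ v ∘ φ` of a linear map `φ : X → Y` on systems `v : Y → Y`. -/
def pull {X Y : Lin C} (φ : X ⟶ Y) (v : Y.obj ⟶ Y.obj) : X.obj ⟶ X.obj :=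
  φ.hom ≫ v ≫ dagger φ

/-- The product comparison `(v, w) ↦ π₀† ∘ v ∘ π₀ + π₁† ∘ w ∘ π₁`. -/
def prodSystem {X Y : Lin C} (v : X.obj ⟶ X.obj) (w : Y.obj ⟶ Y.obj) :
    (X ⊗ Y).obj ⟶ (X ⊗ Y).obj :=
  pull (fst X Y) v + pull (snd X Y) w

/-- The identity decoration on `X`: the image under `X → *` of the only system on the terminal
object. -/
def idSystem (X : Lin C) : X.obj ⟶ X.obj :=
  pull (toUnit X) (𝟙 (𝟙_ (Lin C)).obj)

lemma comp_dagger {T : C} {X Y : Lin C} (φ : X ⟶ Y) (a : T ⟶ Y.obj) :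
    a ≫ dagger φ = lift 0 a ≫ R φ.hom := by
  rw [dagger, ← Category.assoc, comp_lift, precomp_zero, Category.comp_id]

lemma add_comp_dagger {T : C} {X Y : Lin C} (φ : X ⟶ Y) (a b : T ⟶ Y.obj) :
    (a + b) ≫ dagger φ = a ≫ dagger φ + b ≫ dagger φ := by
  simp [comp_dagger, lift_add_R]

lemma dagger_comp {X Y Z : Lin C} (φ : X ⟶ Y) (ψ : Y ⟶ Z) :
    dagger (φ ≫ ψ) = dagger ψ ≫ dagger φ := by
  rw [comp_dagger, dagger, WideSubcategory.comp_def, lift_R_comp, zero_comp_linear φ.property]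
  rfl

lemma dagger_id (X : Lin C) : dagger (𝟙 X) = 𝟙 X.obj := by
  simp [dagger, R_id]

lemma pull_id {X : Lin C} (v : X.obj ⟶ X.obj) : pull (𝟙 X) v = v := by
  simp [pull, dagger_id]

lemma pull_comp {X Y Z : Lin C} (φ : X ⟶ Y) (ψ : Y ⟶ Z) (v : Z.obj ⟶ Z.obj) :
    pull (φ ≫ ψ) v = pull φ (pull ψ v) := by
  simp [pull, dagger_comp]

lemma pull_add {X Y : Lin C} (φ : X ⟶ Y) (v w : Y.obj ⟶ Y.obj) :
    pull φ (v + w) = pull φ v + pull φ w := by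
  simp only [pull, add_comp_dagger, precomp_add]

lemma pull_lift_prodSystem {T X Y : Lin C} (a : T ⟶ X) (b : T ⟶ Y) (v : X.obj ⟶ X.obj)
    (w : Y.obj ⟶ Y.obj) : pull (lift a b) (prodSystem v w) = pull a v + pull b w := by
  rw [prodSystem, pull_add, ← pull_comp, ← pull_comp, lift_fst, lift_snd]

/-! ### Open dynamical systems -/

/-- An open dynamical system with boundaries `X` and `Y`: a span `X ← N → Y` of linear maps with a
system `N → N` in `C`. -/
structure OpenSystem (X Y : Lin C) where
  apex : Lin C
  left : apex ⟶ X
  right : apex ⟶ Y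
  sys : apex.obj ⟶ apex.obj

namespace OpenSystem

variable {W X Y Z : Lin C}

/-- Two open systems are isomorphic if there is an isomorphism of the spans in `Lin(C)` whose action
takes one system to the other. -/
def Iso (A B : OpenSystem X Y) : Prop :=
  ∃ θ : A.apex ≅ B.apex,
    θ.hom ≫ B.left = A.left ∧ θ.hom ≫ B.right = A.right ∧ pull θ.hom B.sys = A.sys

lemma Iso.refl (A : OpenSystem X Y) : A.Iso A :=
  ⟨CategoryTheory.Iso.refl _, by simp, by simp, by simp [pull_id]⟩

lemma Iso.symm {A B : OpenSystem X Y} : A.Iso B → B.Iso A := by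
  rintro ⟨θ, h₁, h₂, h₃⟩
  refine ⟨θ.symm, by simp [← h₁], by simp [← h₂], ?_⟩
  rw [← h₃, ← pull_comp]; simp [pull_id]

lemma Iso.trans {A B D : OpenSystem X Y} : A.Iso B → B.Iso D → A.Iso D := by
  rintro ⟨θ, h₁, h₂, h₃⟩ ⟨η, k₁, k₂, k₃⟩
  exact ⟨θ ≪≫ η, by simp [h₁, k₁], by simp [h₂, k₂], by simp [pull_comp, h₃, k₃]⟩

instance setoid (X Y : Lin C) : Setoid (OpenSystem X Y) :=
  ⟨Iso, Iso.refl, Iso.symm, Iso.trans⟩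

/-- The composite of two open systems formed with a pullback cone `s` over `N → Y ← M`, with legs
`b₀`, `b₁`: the outer span, with the action of `⟨b₀, b₁⟩` on the product comparison. -/
def compose (A : OpenSystem X Y) (B : OpenSystem Y Z) (s : PullbackCone A.right B.left) :
    OpenSystem X Z where
  apex := s.pt
  left := s.fst ≫ A.left
  right := s.snd ≫ B.right
  sys := pull (lift s.fst s.snd) (prodSystem A.sys B.sys)

/-- The monoidal product of open systems. -/
def tensor (A : OpenSystem X Y) (B : OpenSystem W Z) : OpenSystem (X ⊗ W) (Y ⊗ Z) where
  apex := A.apex ⊗ B.apex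
  left := A.left ⊗ₘ B.left
  right := A.right ⊗ₘ B.right
  sys := prodSystem A.sys B.sys

/-- A span of linear maps with the identity decoration. -/
def ofSpan {N : Lin C} (l : N ⟶ X) (r : N ⟶ Y) : OpenSystem X Y where
  apex := N
  left := l
  right := r
  sys := idSystem N

/-- The isomorphism class of a composite depends only on the isomorphism classes of the factors,
and not on the choice of the pullback. -/
lemma compose_congr {A A' : OpenSystem X Y} {B B' : OpenSystem Y Z} (hA : A.Iso A') (hB : B.Iso B')
    {s : PullbackCone A.right B.left} {s' : PullbackCone A'.right B'.left} (hs : IsLimit s)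
    (hs' : IsLimit s') : (A.compose B s).Iso (A'.compose B' s') := by
  obtain ⟨θ, h₁, h₂, h₃⟩ := hA
  obtain ⟨η, k₁, k₂, k₃⟩ := hB
  have e : (s.fst ≫ θ.hom) ≫ A'.right = (s.snd ≫ η.hom) ≫ B'.left := by
    rw [Category.assoc, Category.assoc, h₂, k₁, s.condition]
  have e' : (s'.fst ≫ θ.inv) ≫ A.right = (s'.snd ≫ η.inv) ≫ B.left := by
    rw [← h₂, ← k₁]; simp [s'.condition]
  have f₁ := PullbackCone.IsLimit.lift_fst hs' _ _ e
  have f₂ := PullbackCone.IsLimit.lift_snd hs' _ _ e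
  have g₁ := PullbackCone.IsLimit.lift_fst hs _ _ e'
  have g₂ := PullbackCone.IsLimit.lift_snd hs _ _ e'
  let i : s.pt ≅ s'.pt :=
    { hom := PullbackCone.IsLimit.lift hs' _ _ e
      inv := PullbackCone.IsLimit.lift hs _ _ e'
      hom_inv_id := PullbackCone.IsLimit.hom_ext hs (by simp [g₁, reassoc_of% f₁])
        (by simp [g₂, reassoc_of% f₂])
      inv_hom_id := PullbackCone.IsLimit.hom_ext hs' (by simp [f₁, reassoc_of% g₁])
        (by simp [f₂, reassoc_of% g₂]) }
  refine ⟨i, ?_, ?_, ?_⟩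
  · simp [compose, i, reassoc_of% f₁, h₁]
  · simp [compose, i, reassoc_of% f₂, k₂]
  · simp only [compose, pull_lift_prodSystem, pull_add, i]
    rw [← pull_comp, ← pull_comp, f₁, f₂, pull_comp, pull_comp, h₃, k₃]

lemma tensor_congr {A A' : OpenSystem X Y} {B B' : OpenSystem W Z} (hA : A.Iso A')
    (hB : B.Iso B') : (A.tensor B).Iso (A'.tensor B') := by
  obtain ⟨θ, h₁, h₂, h₃⟩ := hA
  obtain ⟨η, k₁, k₂, k₃⟩ := hB
  refine ⟨θ ⊗ᵢ η, ?_, ?_, ?_⟩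
  · simp [tensor, ← h₁, ← k₁]
  · simp [tensor, ← h₂, ← k₂]
  · simp only [tensor, prodSystem, pull_add, tensorIso_hom]
    rw [← pull_comp, ← pull_comp, tensorHom_fst, tensorHom_snd, pull_comp, pull_comp, h₃, k₃]

end OpenSystem

end Dynamics

/-! ### Hypergraph categories -/

/-- A hypergraph category: a symmetric monoidal category in which every object carries a special
commutative Frobenius monoid, compatibly with the monoidal product. The commutative comonoids, with
their compatibility, are the part `CopyDiscardCategory`. -/
class HypergraphCategory (H : Type u) [Category.{v} H] [MonoidalCategory H]
    extends CopyDiscardCategory H where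
  monObj (X : H) : MonObj X
  mul_comm (X : H) : (β_ X X).hom ≫ (monObj X).mul = (monObj X).mul
  frobenius_left (X : H) :
    ((comonObj X).comul ▷ X) ≫ (α_ X X X).hom ≫ (X ◁ (monObj X).mul) =
      (monObj X).mul ≫ (comonObj X).comul
  frobenius_right (X : H) :
    (X ◁ (comonObj X).comul) ≫ (α_ X X X).inv ≫ ((monObj X).mul ▷ X) =
      (monObj X).mul ≫ (comonObj X).comul
  special (X : H) : (comonObj X).comul ≫ (monObj X).mul = 𝟙 X
  mul_tensor (X Y : H) :
    (monObj (X ⊗ Y)).mul = tensorμ X Y X Y ≫ ((monObj X).mul ⊗ₘ (monObj Y).mul)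
  one_tensor (X Y : H) :
    (monObj (X ⊗ Y)).one = (λ_ (𝟙_ H)).inv ≫ ((monObj X).one ⊗ₘ (monObj Y).one)
  mul_unit : (monObj (𝟙_ H)).mul = (λ_ (𝟙_ H)).hom
  one_unit : (monObj (𝟙_ H)).one = 𝟙 (𝟙_ H)

/-- The operations of a hypergraph category with set of objects `Obj`, without any laws. -/
structure HypergraphData (Obj : Type u) where
  Hom : Obj → Obj → Type w
  id (X : Obj) : Hom X X
  comp {X Y Z : Obj} : Hom X Y → Hom Y Z → Hom X Z
  tensorObj : Obj → Obj → Obj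
  tensorUnit : Obj
  tensorHom {X Y X' Y' : Obj} : Hom X Y → Hom X' Y' → Hom (tensorObj X X') (tensorObj Y Y')
  associator (X Y Z : Obj) : Hom (tensorObj (tensorObj X Y) Z) (tensorObj X (tensorObj Y Z))
  leftUnitor (X : Obj) : Hom (tensorObj tensorUnit X) X
  rightUnitor (X : Obj) : Hom (tensorObj X tensorUnit) X
  braiding (X Y : Obj) : Hom (tensorObj X Y) (tensorObj Y X)
  mul (X : Obj) : Hom (tensorObj X X) X
  one (X : Obj) : Hom tensorUnit X
  comul (X : Obj) : Hom X (tensorObj X X)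
  counit (X : Obj) : Hom X tensorUnit

/-- The operations of a given hypergraph category. -/
def HypergraphData.of (H : Type u) [Category.{w} H] [MonoidalCategory H] [HypergraphCategory H] :
    HypergraphData.{u, w} H where
  Hom X Y := X ⟶ Y
  id X := 𝟙 X
  comp f g := f ≫ g
  tensorObj X Y := X ⊗ Y
  tensorUnit := 𝟙_ H
  tensorHom f g := f ⊗ₘ g
  associator X Y Z := (α_ X Y Z).hom
  leftUnitor X := (λ_ X).hom
  rightUnitor X := (ρ_ X).hom
  braiding X Y := (β_ X Y).hom
  mul X := (HypergraphCategory.monObj X).mul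
  one X := (HypergraphCategory.monObj X).one
  comul X := (CopyDiscardCategory.comonObj X).comul
  counit X := (CopyDiscardCategory.comonObj X).counit

namespace Dynamics

open OpenSystem

/-- The objects of `Dynam`, which are those of `C`. -/
structure Dynam (C : Type u) where
  obj : C

variable (C : Type u) [Category.{v} C] [CartesianMonoidalCategory C] [CartesianReverseDerivative C]

variable {C} in
/-- An object of `Dynam`, as an object of `Lin(C)`. -/
def Dynam.lin (X : Dynam C) : Lin C := ⟨X.obj⟩

/-- The operations of `Dynam`. Morphisms are isomorphism classes of open dynamical systems, they
are composed by pullback and multiplied by the product comparison. The structure maps are those of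
spans in `Lin(C)`, with the identity decoration. -/
noncomputable def dynamData [HasFiniteLimits (Lin C)] :
    HypergraphData.{u, max u v} (Dynam C) where
  Hom X Y := Quotient (OpenSystem.setoid X.lin Y.lin)
  id X := ⟦ofSpan (𝟙 X.lin) (𝟙 X.lin)⟧
  comp := Quotient.map₂
    (fun A B => A.compose B (pullback.cone A.right B.left))
    (fun A A' hA B B' hB =>
      compose_congr hA hB (pullback.isLimit A.right B.left) (pullback.isLimit A'.right B'.left))
  tensorObj X Y := ⟨X.obj ⊗ Y.obj⟩
  tensorUnit := ⟨𝟙_ C⟩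
  tensorHom := Quotient.map₂ tensor (fun _ _ hA _ _ hB => tensor_congr hA hB)
  associator X Y Z := ⟦ofSpan (𝟙 ((X.lin ⊗ Y.lin) ⊗ Z.lin)) (α_ X.lin Y.lin Z.lin).hom⟧
  leftUnitor X := ⟦ofSpan (𝟙 (𝟙_ (Lin C) ⊗ X.lin)) (λ_ X.lin).hom⟧
  rightUnitor X := ⟦ofSpan (𝟙 (X.lin ⊗ 𝟙_ (Lin C))) (ρ_ X.lin).hom⟧
  braiding X Y := ⟦ofSpan (𝟙 (X.lin ⊗ Y.lin)) (β_ X.lin Y.lin).hom⟧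
  mul X := ⟦ofSpan (lift (𝟙 X.lin) (𝟙 X.lin)) (𝟙 X.lin)⟧
  one X := ⟦ofSpan (toUnit X.lin) (𝟙 X.lin)⟧
  comul X := ⟦ofSpan (𝟙 X.lin) (lift (𝟙 X.lin) (𝟙 X.lin))⟧
  counit X := ⟦ofSpan (𝟙 X.lin) (toUnit X.lin)⟧

end Dynamics

/-! The identity decoration is the zero system: on the terminal object all systems coincide, and a
dagger sends zero to zero by RD.2. Since `pull` is additive and contravariantly functorial, a
composite over a pullback with legs `p`, `q` carries the sum `pull p v + pull q w`. Decorations are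
thus only restricted and added, and every law splits into a statement about spans in `Lin C` and a
rearrangement of a sum.

For the spans, a linear map has a `graph` (covariant) and a `cograph` (contravariant). Both respect
composition and products, and they agree on isomorphisms up to inversion (`graph_hom`). Coherence
and the comonoid laws are images under `graph` of identities in `Lin C`; the monoid laws are images
under `cograph` of the same diagonal identities. A graph followed by a cograph needs an actual
pullback (`graph_comp_cograph`): the Frobenius and special laws each come from one pullback square
of diagonals. Associativity is pasting of pullbacks, and interchange holds because products of
pullback squares are pullback squares. -/

/-! ### Pullback squares and diagonals in a cartesian monoidal category. -/

section

variable {L : Type u} [Category.{v} L] [CartesianMonoidalCategory L]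

/-- The product of two pullback squares is a pullback square. -/
lemma isPullback_tensorHom {P A B Y P' A' B' Y' : L} {p : P ⟶ A} {q : P ⟶ B} {f : A ⟶ Y}
    {g : B ⟶ Y} {p' : P' ⟶ A'} {q' : P' ⟶ B'} {f' : A' ⟶ Y'} {g' : B' ⟶ Y'}
    (h : IsPullback p q f g) (h' : IsPullback p' q' f' g') :
    IsPullback (p ⊗ₘ p') (q ⊗ₘ q') (f ⊗ₘ f') (g ⊗ₘ g') := by
  refine ⟨⟨by simp [h.w, h'.w]⟩, ⟨PullbackCone.IsLimit.mk _ (fun s => lift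
    (h.lift (s.fst ≫ fst _ _) (s.snd ≫ fst _ _) ?_)
    (h'.lift (s.fst ≫ snd _ _) (s.snd ≫ snd _ _) ?_)) ?_ ?_ ?_⟩⟩
  · simpa using s.condition =≫ fst _ _
  · simpa using s.condition =≫ snd _ _
  · intro s; ext <;> simp
  · intro s; ext <;> simp
  · intro s m h₁ h₂
    ext
    · apply h.hom_ext
      · simpa using h₁ =≫ fst _ _
      · simpa using h₂ =≫ fst _ _
    · apply h'.hom_ext
      · simpa using h₁ =≫ snd _ _
      · simpa using h₂ =≫ snd _ _

/-- The diagonal is a monomorphism. -/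
lemma isPullback_diagonal (X : L) :
    IsPullback (𝟙 X) (𝟙 X) (lift (𝟙 X) (𝟙 X)) (lift (𝟙 X) (𝟙 X)) := by
  refine ⟨⟨rfl⟩, ⟨PullbackCone.IsLimit.mk _ (fun s => s.fst) (fun s => by simp) (fun s => ?_)
    (fun s m h₁ _ => by simpa using h₁)⟩⟩
  simpa using s.condition =≫ fst _ _

/-- The Frobenius law for the diagonal, as a pullback square. -/
lemma isPullback_frobenius_left (X : L) :
    IsPullback (lift (𝟙 X) (𝟙 X)) (lift (𝟙 X) (𝟙 X))
      ((lift (𝟙 X) (𝟙 X) ⊗ₘ 𝟙 X) ≫ (α_ X X X).hom) (𝟙 X ⊗ₘ lift (𝟙 X) (𝟙 X)) := by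
  -- For a cone with legs `(a, b)` and `(c, d)`, commutativity reads `(a, (a, b)) = (c, (d, d))`.
  -- All four coordinates agree, so any of them is the factorization.
  refine ⟨⟨by ext <;> simp⟩, ⟨PullbackCone.IsLimit.mk _ (fun s => s.fst ≫ fst _ _)
    (fun s => ?_) (fun s => ?_) (fun s m h₁ _ => by simpa using h₁ =≫ fst _ _)⟩⟩
  all_goals
    have e₁ := s.condition =≫ fst _ _
    have e₂ := (s.condition =≫ snd _ _) =≫ fst _ _
    have e₃ := (s.condition =≫ snd _ _) =≫ snd _ _
    simp at e₁ e₂ e₃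
    ext <;> simp [e₁, e₃]
  · rw [← e₂, e₁]
  · rw [← e₁, e₂]

/-- The mirror image of `isPullback_frobenius_left`. -/
lemma isPullback_frobenius_right (X : L) :
    IsPullback (lift (𝟙 X) (𝟙 X)) (lift (𝟙 X) (𝟙 X))
      ((𝟙 X ⊗ₘ lift (𝟙 X) (𝟙 X)) ≫ (α_ X X X).inv) (lift (𝟙 X) (𝟙 X) ⊗ₘ 𝟙 X) := by
  -- Here the cone condition is `((a, b), b) = ((c, c), d)`.
  refine ⟨⟨by ext <;> simp⟩, ⟨PullbackCone.IsLimit.mk _ (fun s => s.fst ≫ fst _ _)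
    (fun s => ?_) (fun s => ?_) (fun s m h₁ _ => by simpa using h₁ =≫ fst _ _)⟩⟩
  all_goals
    have e₁ := (s.condition =≫ fst _ _) =≫ fst _ _
    have e₂ := (s.condition =≫ fst _ _) =≫ snd _ _
    have e₃ := s.condition =≫ snd _ _
    simp at e₁ e₂ e₃
    ext <;> simp [e₁, e₂]
  exact e₂.symm.trans e₃

/-- The inverse unitor serves both variances: `graph` turns this into a counit law, `cograph` into a
unit law. -/
lemma diagonal_counit (X : L) :
    lift (𝟙 X) (𝟙 X) ≫ (toUnit X ⊗ₘ 𝟙 X) = (λ_ X).inv := by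
  ext; simp

lemma diagonal_counit' (X : L) :
    lift (𝟙 X) (𝟙 X) ≫ (𝟙 X ⊗ₘ toUnit X) = (ρ_ X).inv := by
  ext; simp

lemma diagonal_assoc (X : L) :
    lift (𝟙 X) (𝟙 X) ≫ (𝟙 X ⊗ₘ lift (𝟙 X) (𝟙 X)) =
      lift (𝟙 X) (𝟙 X) ≫ (lift (𝟙 X) (𝟙 X) ⊗ₘ 𝟙 X) ≫ (α_ X X X).hom := by
  ext <;> simp

lemma diagonal_tensorUnit : lift (𝟙 (𝟙_ L)) (𝟙 (𝟙_ L)) = (λ_ (𝟙_ L)).inv := by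
  ext

section

variable [BraidedCategory L]

lemma diagonal_comm (X : L) :
    lift (𝟙 X) (𝟙 X) ≫ (β_ X X).hom = lift (𝟙 X) (𝟙 X) := by
  ext <;> simp

lemma diagonal_tensor (X Y : L) :
    lift (𝟙 (X ⊗ Y)) (𝟙 (X ⊗ Y)) =
      (lift (𝟙 X) (𝟙 X) ⊗ₘ lift (𝟙 Y) (𝟙 Y)) ≫ tensorμ X X Y Y := by
  ext <;> simp [tensorμ]

/-- The interchange of the middle factors, as an isomorphism. -/
@[simps]
def tensorμIso (X X' Y Y' : L) : (X ⊗ X') ⊗ Y ⊗ Y' ≅ (X ⊗ Y) ⊗ X' ⊗ Y' where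
  hom := tensorμ X X' Y Y'
  inv := tensorδ X X' Y Y'

/-- Reversing spans replaces the interchange by its inverse; this is the form that the
multiplication on a product requires. -/
lemma diagonal_tensor' (X Y : L) :
    lift (𝟙 (X ⊗ Y)) (𝟙 (X ⊗ Y)) =
      (lift (𝟙 X) (𝟙 X) ⊗ₘ lift (𝟙 Y) (𝟙 Y)) ≫ tensorδ X Y X Y := by
  rw [← cancel_mono (tensorμIso X Y X Y).hom]
  ext <;> simp [tensorμ]

end

end

/-! ### The zero decoration. -/

namespace Dynamics

open CartesianLeftAdditive CartesianReverseDerivative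

variable {C : Type u} [Category.{v} C] [CartesianMonoidalCategory C] [CartesianReverseDerivative C]

lemma pull_zero {X Y : Lin C} (φ : X ⟶ Y) : pull φ 0 = 0 := by
  have h : (0 : Y.obj ⟶ Y.obj) ≫ dagger φ = 0 := by rw [comp_dagger, lift_zero_R]
  rw [pull, h, precomp_zero]

/-- Maps into the terminal object are unique, so its identity is zero, and zero pulls back to zero.
-/
lemma idSystem_eq_zero (X : Lin C) : idSystem X = 0 := by
  rw [idSystem, ← pull_zero (toUnit X)]
  exact congrArg _ (toUnit_unique _ _)

namespace OpenSystem

variable {X Y Z W X' Y' Z' W' : Lin C}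

/-- Isomorphism classes of open systems. -/
abbrev IsoClass (X Y : Lin C) := Quotient (setoid X Y)

/-! ### Graphs and cographs of linear maps. -/

namespace IsoClass

/-- The product of classes. -/
def tensor (a : IsoClass X Y) (b : IsoClass W Z) : IsoClass (X ⊗ W) (Y ⊗ Z) :=
  Quotient.map₂ OpenSystem.tensor (fun _ _ hA _ _ hB => tensor_congr hA hB) a b

/-- The class of the graph of a linear map. -/
def graph (f : X ⟶ Y) : IsoClass X Y := ⟦ofSpan (𝟙 X) f⟧

/-- The class of the reversed graph of a linear map. -/
def cograph (f : Y ⟶ X) : IsoClass X Y := ⟦ofSpan f (𝟙 Y)⟧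

/-- The isomorphism `e` between the apexes identifies the two spans, and both decorations are zero.
-/
lemma graph_hom (e : X ≅ Y) : graph e.hom = cograph e.inv :=
  Quotient.sound ⟨e, by simp [ofSpan], by simp [ofSpan],
    by simp [ofSpan, idSystem_eq_zero, pull_zero]⟩

lemma ofSpan_tensor {N M : Lin C} (l : N ⟶ X) (r : N ⟶ Y) (l' : M ⟶ W) (r' : M ⟶ Z) :
    (ofSpan l r).tensor (ofSpan l' r') = ofSpan (l ⊗ₘ l') (r ⊗ₘ r') := by
  simp only [OpenSystem.tensor, ofSpan, prodSystem, idSystem_eq_zero, pull_zero]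
  exact congrArg _ (add_zero _)

lemma graph_tensor (f : X ⟶ Y) (g : W ⟶ Z) : (graph f).tensor (graph g) = graph (f ⊗ₘ g) :=
  (congrArg (Quotient.mk _) (ofSpan_tensor _ _ _ _)).trans (by rw [id_tensorHom_id]; rfl)

lemma cograph_tensor (f : Y ⟶ X) (g : Z ⟶ W) :
    (cograph f).tensor (cograph g) = cograph (f ⊗ₘ g) :=
  (congrArg (Quotient.mk _) (ofSpan_tensor _ _ _ _)).trans (by rw [id_tensorHom_id]; rfl)

lemma graph_inv (e : X ≅ Y) : graph e.inv = cograph e.hom := graph_hom e.symm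

/-- The class of the diagonal of `X`. -/
def comul (X : Lin C) : IsoClass X (X ⊗ X) := graph (lift (𝟙 X) (𝟙 X))

/-- The class of the reversed diagonal of `X`. -/
def mul (X : Lin C) : IsoClass (X ⊗ X) X := cograph (lift (𝟙 X) (𝟙 X))

/-- The class of the map to the terminal object. -/
def counit (X : Lin C) : IsoClass X (𝟙_ (Lin C)) := graph (toUnit X)

/-- The class of the reversed map to the terminal object. -/
def one (X : Lin C) : IsoClass (𝟙_ (Lin C)) X := cograph (toUnit X)

lemma comul_unit : comul (𝟙_ (Lin C)) = graph (λ_ (𝟙_ (Lin C))).inv := by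
  rw [comul, diagonal_tensorUnit]

lemma counit_unit : counit (𝟙_ (Lin C)) = graph (𝟙 (𝟙_ (Lin C))) :=
  congrArg graph (toUnit_unique _ _)

lemma mul_unit : mul (𝟙_ (Lin C)) = graph (λ_ (𝟙_ (Lin C))).hom := by
  rw [mul, diagonal_tensorUnit, graph_hom]

lemma one_unit : one (𝟙_ (Lin C)) = graph (𝟙 (𝟙_ (Lin C))) :=
  congrArg cograph (toUnit_unique _ _)

/-! ### Composition of classes. -/

variable [HasFiniteLimits (Lin C)]

/-- The composite of classes. -/
noncomputable def comp (a : IsoClass X Y) (b : IsoClass Y Z) : IsoClass X Z :=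
  Quotient.map₂ (fun A B => A.compose B (pullback.cone A.right B.left))
    (fun A A' hA B B' hB =>
      compose_congr hA hB (pullback.isLimit A.right B.left) (pullback.isLimit A'.right B'.left)) a b

/-- Frees composites from the chosen pullback, so that each computation can use the most convenient
one. -/
lemma mk_comp_mk (A : OpenSystem X Y) (B : OpenSystem Y Z) {s : PullbackCone A.right B.left}
    (hs : IsLimit s) : comp ⟦A⟧ ⟦B⟧ = ⟦A.compose B s⟧ :=
  Quotient.sound (compose_congr (Iso.refl A) (Iso.refl B) (pullback.isLimit _ _) hs)

/-- The criterion behind the composite computations below. By `pull_lift_prodSystem` the composite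
system is a sum of two restrictions, so the identity of the apex is the required isomorphism. -/
lemma mk_comp_mk_eq {A : OpenSystem X Y} {B : OpenSystem Y Z} {E : OpenSystem X Z}
    {p : E.apex ⟶ A.apex} {q : E.apex ⟶ B.apex} (h : IsPullback p q A.right B.left)
    (hl : p ≫ A.left = E.left) (hr : q ≫ B.right = E.right)
    (hs : pull p A.sys + pull q B.sys = E.sys) : comp ⟦A⟧ ⟦B⟧ = ⟦E⟧ := by
  refine (mk_comp_mk A B h.isLimit).trans (Quotient.sound ⟨CategoryTheory.Iso.refl _, ?_, ?_, ?_⟩)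
  · exact (Category.id_comp _).trans hl.symm
  · exact (Category.id_comp _).trans hr.symm
  · exact (pull_id _).trans (hs.symm.trans (pull_lift_prodSystem p q _ _).symm)

/-- Both bracketings have the iterated pullback as apex, by pasting, and its system is the sum of
the restrictions of the three given systems. -/
lemma comp_assoc (a : IsoClass W X) (b : IsoClass X Y) (c : IsoClass Y Z) :
    comp (comp a b) c = comp a (comp b c) := by
  induction a using Quotient.inductionOn with | _ A
  induction b using Quotient.inductionOn with | _ B
  induction c using Quotient.inductionOn with | _ E
  have hP := IsPullback.of_hasPullback A.right B.left
  have hQ := IsPullback.of_hasPullback B.right E.left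
  have hR := IsPullback.of_hasPullback (pullback.snd A.right B.left) (pullback.fst B.right E.left)
  set P := pullback A.right B.left
  set Q := pullback B.right E.left
  set p₁ := pullback.fst A.right B.left
  set p₂ := pullback.snd A.right B.left
  set q₁ := pullback.fst B.right E.left
  set q₂ := pullback.snd B.right E.left
  set r₁ := pullback.fst p₂ q₁
  set r₂ := pullback.snd p₂ q₁
  have h₁ : comp ⟦A⟧ ⟦B⟧ =
      (⟦⟨P, p₁ ≫ A.left, p₂ ≫ B.right, pull p₁ A.sys + pull p₂ B.sys⟩⟧ : IsoClass W Y) :=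
    mk_comp_mk_eq (p := p₁) (q := p₂) hP rfl rfl rfl
  have h₂ : comp ⟦B⟧ ⟦E⟧ =
      (⟦⟨Q, q₁ ≫ B.left, q₂ ≫ E.right, pull q₁ B.sys + pull q₂ E.sys⟩⟧ : IsoClass X Z) :=
    mk_comp_mk_eq (p := q₁) (q := q₂) hQ rfl rfl rfl
  rw [h₁, h₂]
  trans (⟦⟨pullback p₂ q₁, r₁ ≫ p₁ ≫ A.left, r₂ ≫ q₂ ≫ E.right,
    pull (r₁ ≫ p₁) A.sys + pull (r₁ ≫ p₂) B.sys + pull (r₂ ≫ q₂) E.sys⟩⟧ : IsoClass W Z)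
  · refine mk_comp_mk_eq (p := r₁) (q := r₂ ≫ q₂) (hR.paste_vert hQ) rfl
      (by simp) ?_
    simp [pull_add, pull_comp]
  · refine (mk_comp_mk_eq (p := r₁ ≫ p₁) (q := r₂) (hR.paste_horiz hP) (by simp) rfl ?_).symm
    simp only [pull_add, ← pull_comp]
    -- The middle system is restricted along `r₁ ≫ p₂` in one bracketing and along `r₂ ≫ q₁` in the
    -- other; the pullback square equates them.
    rw [hR.w, add_assoc]

/-- The pullback is along an identity, so the apex is unchanged, and the zero decoration adds
nothing. -/
lemma mk_comp_graph (A : OpenSystem X Y) (f : Y ⟶ Z) :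
    comp ⟦A⟧ (graph f) = ⟦⟨A.apex, A.left, A.right ≫ f, A.sys⟩⟧ :=
  mk_comp_mk_eq (p := 𝟙 A.apex) (q := A.right) IsPullback.of_id_fst (by simp) rfl
    (by simp [ofSpan, idSystem_eq_zero, pull_zero, pull_id])

lemma cograph_comp_mk (f : Y ⟶ X) (A : OpenSystem Y Z) :
    comp (cograph f) ⟦A⟧ = ⟦⟨A.apex, A.left ≫ f, A.right, A.sys⟩⟧ :=
  mk_comp_mk_eq (p := A.left) (q := 𝟙 A.apex) IsPullback.of_id_snd rfl (by simp)
    (by simp [ofSpan, idSystem_eq_zero, pull_zero, pull_id])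

/-- Read as a cograph, an isomorphism on the left merely changes the left leg. This makes the
naturality proofs free of pullbacks. -/
lemma graph_hom_comp_mk (e : X ≅ Y) (A : OpenSystem Y Z) :
    comp (graph e.hom) ⟦A⟧ = ⟦⟨A.apex, A.left ≫ e.inv, A.right, A.sys⟩⟧ := by
  rw [graph_hom, cograph_comp_mk]

lemma comp_id (a : IsoClass X Y) : comp a (graph (𝟙 Y)) = a := by
  induction a using Quotient.inductionOn with | _ A
  rw [mk_comp_graph, Category.comp_id]

lemma id_comp (a : IsoClass X Y) : comp (graph (𝟙 X)) a = a := by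
  induction a using Quotient.inductionOn with | _ A
  exact (cograph_comp_mk (𝟙 X) A).trans (by rw [Category.comp_id])

lemma graph_comp (f : X ⟶ Y) (g : Y ⟶ Z) : comp (graph f) (graph g) = graph (f ≫ g) :=
  mk_comp_graph _ _

lemma cograph_comp (f : Y ⟶ X) (g : Z ⟶ Y) : comp (cograph f) (cograph g) = cograph (g ≫ f) :=
  cograph_comp_mk _ _

lemma cograph_comp_graph (f : Y ⟶ X) (g : Y ⟶ Z) :
    comp (cograph f) (graph g) = ⟦ofSpan f g⟧ :=
  (mk_comp_graph _ _).trans (by rw [ofSpan, Category.id_comp]; rfl)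

lemma graph_comp_cograph {P : Lin C} {f : X ⟶ Y} {g : Z ⟶ Y} {p : P ⟶ X} {q : P ⟶ Z}
    (h : IsPullback p q f g) : comp (graph f) (cograph g) = ⟦ofSpan p q⟧ :=
  mk_comp_mk_eq (p := p) (q := q) h (Category.comp_id _) (Category.comp_id _)
    (by simp only [ofSpan, idSystem_eq_zero, pull_zero]; exact add_zero _)

/-! ### Interchange and naturality of the structure maps. -/

lemma tensor_comp_tensor (a : IsoClass X Y) (b : IsoClass X' Y') (c : IsoClass Y Z) (d : IsoClass Y' Z') :
    comp (tensor a b) (tensor c d) = tensor (comp a c) (comp b d) := by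
  induction a using Quotient.inductionOn with | _ A
  induction b using Quotient.inductionOn with | _ B
  induction c using Quotient.inductionOn with | _ E
  induction d using Quotient.inductionOn with | _ F
  refine mk_comp_mk_eq (A := A.tensor B) (B := E.tensor F)
    (isPullback_tensorHom (IsPullback.of_hasPullback A.right E.left)
      (IsPullback.of_hasPullback B.right F.left)) ?_ ?_ ?_
  · exact tensorHom_comp_tensorHom _ _ _ _
  · exact tensorHom_comp_tensorHom _ _ _ _
  · simp only [OpenSystem.tensor, compose, prodSystem, pull_add,
      ← pull_comp, tensorHom_fst, tensorHom_snd,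
      lift_fst, lift_snd]
    -- One side groups the four restricted systems by composition stage, the other by tensor factor.
    rw [add_add_add_comm]
    rfl

/-- The structure map of the apexes is the isomorphism of spans; on systems only associativity of
addition remains. The unitors and the braiding work likewise, with the zero laws and commutativity.
-/
lemma associator_naturality (a : IsoClass X X') (b : IsoClass Y Y') (c : IsoClass Z Z') :
    comp (tensor (tensor a b) c) (graph (α_ X' Y' Z').hom) =
      comp (graph (α_ X Y Z).hom) (tensor a (tensor b c)) := by
  induction a using Quotient.inductionOn with | _ A
  induction b using Quotient.inductionOn with | _ B
  induction c using Quotient.inductionOn with | _ E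
  refine (mk_comp_graph ((A.tensor B).tensor E) _).trans
    (Eq.trans ?_ (graph_hom_comp_mk (α_ X Y Z) (A.tensor (B.tensor E))).symm)
  refine Quotient.sound ⟨α_ A.apex B.apex E.apex, ?_, ?_, ?_⟩
  · simp [OpenSystem.tensor]
  · simp [OpenSystem.tensor]
  · simp only [OpenSystem.tensor, prodSystem, pull_add, ← pull_comp, associator_hom_fst,
      associator_hom_snd_fst, associator_hom_snd_snd, add_assoc]

lemma leftUnitor_naturality (a : IsoClass X Y) :
    comp (tensor (graph (𝟙 (𝟙_ (Lin C)))) a) (graph (λ_ Y).hom) = comp (graph (λ_ X).hom) a := by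
  induction a using Quotient.inductionOn with | _ A
  refine (mk_comp_graph ((ofSpan _ _).tensor A) _).trans
    (Eq.trans ?_ (graph_hom_comp_mk (λ_ X) A).symm)
  refine Quotient.sound ⟨λ_ A.apex, ?_, ?_, ?_⟩
  · simp [OpenSystem.tensor, ofSpan]
  · simp [OpenSystem.tensor, ofSpan]
  · have h : (λ_ A.apex).hom = snd _ _ := leftUnitor_hom _
    simp only [OpenSystem.tensor, ofSpan, prodSystem, idSystem_eq_zero, pull_zero, h]
    exact (zero_add _).symm

lemma rightUnitor_naturality (a : IsoClass X Y) :
    comp (tensor a (graph (𝟙 (𝟙_ (Lin C))))) (graph (ρ_ Y).hom) = comp (graph (ρ_ X).hom) a := by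
  induction a using Quotient.inductionOn with | _ A
  refine (mk_comp_graph (A.tensor (ofSpan _ _)) _).trans
    (Eq.trans ?_ (graph_hom_comp_mk (ρ_ X) A).symm)
  refine Quotient.sound ⟨ρ_ A.apex, ?_, ?_, ?_⟩
  · simp [OpenSystem.tensor, ofSpan]
  · simp [OpenSystem.tensor, ofSpan]
  · have h : (ρ_ A.apex).hom = fst _ _ := rightUnitor_hom _
    simp only [OpenSystem.tensor, ofSpan, prodSystem, idSystem_eq_zero, pull_zero, h]
    exact (add_zero _).symm

lemma braiding_naturality (a : IsoClass X Y) (b : IsoClass X' Y') :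
    comp (tensor a b) (graph (β_ Y Y').hom) = comp (graph (β_ X X').hom) (tensor b a) := by
  induction a using Quotient.inductionOn with | _ A
  induction b using Quotient.inductionOn with | _ B
  refine (mk_comp_graph (A.tensor B) _).trans
    (Eq.trans ?_ (graph_hom_comp_mk (β_ X X') (B.tensor A)).symm)
  refine Quotient.sound ⟨β_ A.apex B.apex, ?_, ?_, ?_⟩
  · simp [OpenSystem.tensor]
  · simp [OpenSystem.tensor]
  · simp only [OpenSystem.tensor, prodSystem, pull_add, ← pull_comp, braiding_hom_fst,
      braiding_hom_snd, add_comm]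

/-! ### Coherence, transported from `Lin C` along `graph`. -/

lemma graph_hom_comp_graph_inv (e : X ≅ Y) : comp (graph e.hom) (graph e.inv) = graph (𝟙 X) := by
  rw [graph_comp, e.hom_inv_id]

lemma graph_inv_comp_graph_hom (e : X ≅ Y) : comp (graph e.inv) (graph e.hom) = graph (𝟙 Y) :=
  graph_hom_comp_graph_inv e.symm

lemma pentagon (W X Y Z : Lin C) :
    comp (tensor (graph (α_ W X Y).hom) (graph (𝟙 Z)))
      (comp (graph (α_ W (X ⊗ Y) Z).hom) (tensor (graph (𝟙 W)) (graph (α_ X Y Z).hom))) =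
    comp (graph (α_ (W ⊗ X) Y Z).hom) (graph (α_ W X (Y ⊗ Z)).hom) := by
  simp only [graph_tensor, graph_comp, tensorHom_id, id_tensorHom, MonoidalCategory.pentagon]

lemma triangle (X Y : Lin C) :
    comp (graph (α_ X (𝟙_ (Lin C)) Y).hom) (tensor (graph (𝟙 X)) (graph (λ_ Y).hom)) =
      tensor (graph (ρ_ X).hom) (graph (𝟙 Y)) := by
  simp only [graph_tensor, graph_comp, tensorHom_id, id_tensorHom, MonoidalCategory.triangle]

lemma hexagon_forward (X Y Z : Lin C) :
    comp (graph (α_ X Y Z).hom) (comp (graph (β_ X (Y ⊗ Z)).hom) (graph (α_ Y Z X).hom)) =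
      comp (tensor (graph (β_ X Y).hom) (graph (𝟙 Z)))
        (comp (graph (α_ Y X Z).hom) (tensor (graph (𝟙 Y)) (graph (β_ X Z).hom))) := by
  simp only [graph_tensor, graph_comp, tensorHom_id, id_tensorHom, BraidedCategory.hexagon_forward]

lemma hexagon_reverse (X Y Z : Lin C) :
    comp (graph (α_ X Y Z).inv) (comp (graph (β_ (X ⊗ Y) Z).hom) (graph (α_ Z X Y).inv)) =
      comp (tensor (graph (𝟙 X)) (graph (β_ Y Z).hom))
        (comp (graph (α_ X Z Y).inv) (tensor (graph (β_ X Z).hom) (graph (𝟙 Y)))) := by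
  simp only [graph_tensor, graph_comp, tensorHom_id, id_tensorHom, BraidedCategory.hexagon_reverse]

lemma symmetry (X Y : Lin C) :
    comp (graph (β_ X Y).hom) (graph (β_ Y X).hom) = graph (𝟙 (X ⊗ Y)) := by
  rw [graph_comp, SymmetricCategory.symmetry]

/-- The left side is the interchange of `Dynam` unfolded into its structure maps, with whiskering as
a product with an identity graph. -/
lemma graph_tensorμ (X X' Y Y' : Lin C) :
    comp (graph (α_ X X' (Y ⊗ Y')).hom)
      (comp (tensor (graph (𝟙 X)) (graph (α_ X' Y Y').inv))
        (comp (tensor (graph (𝟙 X)) (tensor (graph (β_ X' Y).hom) (graph (𝟙 Y'))))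
          (comp (tensor (graph (𝟙 X)) (graph (α_ Y X' Y').hom))
            (graph (α_ X Y (X' ⊗ Y')).inv)))) = graph (tensorμ X X' Y Y') := by
  simp only [graph_tensor, graph_comp, tensorHom_id, id_tensorHom, tensorμ]

/-! ### The comonoid laws, from the diagonal. -/

lemma counit_comul (X : Lin C) :
    comp (comul X) (tensor (counit X) (graph (𝟙 X))) = graph (λ_ X).inv := by
  rw [comul, counit, graph_tensor, graph_comp, diagonal_counit]

lemma comul_counit (X : Lin C) :
    comp (comul X) (tensor (graph (𝟙 X)) (counit X)) = graph (ρ_ X).inv := by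
  rw [comul, counit, graph_tensor, graph_comp, diagonal_counit']

lemma comul_assoc (X : Lin C) :
    comp (comul X) (tensor (graph (𝟙 X)) (comul X)) =
      comp (comul X) (comp (tensor (comul X) (graph (𝟙 X))) (graph (α_ X X X).hom)) := by
  simp only [comul, graph_tensor, graph_comp]
  rw [diagonal_assoc]

lemma comul_comm (X : Lin C) : comp (comul X) (graph (β_ X X).hom) = comul X := by
  rw [comul, graph_comp, diagonal_comm]

lemma comul_tensor (X Y : Lin C) :
    comul (X ⊗ Y) = comp (tensor (comul X) (comul Y)) (graph (tensorμ X X Y Y)) := by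
  simp only [comul, graph_tensor, graph_comp]
  rw [diagonal_tensor]

lemma counit_tensor (X Y : Lin C) :
    counit (X ⊗ Y) = comp (tensor (counit X) (counit Y)) (graph (λ_ (𝟙_ (Lin C))).hom) := by
  simp only [counit, graph_tensor, graph_comp]
  exact congrArg graph (toUnit_unique _ _)

/-! ### The monoid laws, from the reversed diagonal. -/

lemma one_mul (X : Lin C) :
    comp (tensor (one X) (graph (𝟙 X))) (mul X) = graph (λ_ X).hom := by
  rw [graph_hom, ← diagonal_counit, ← cograph_comp, ← cograph_tensor]
  -- The identity span is at once the graph and the cograph of the identity.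
  rfl

lemma mul_one (X : Lin C) :
    comp (tensor (graph (𝟙 X)) (one X)) (mul X) = graph (ρ_ X).hom := by
  rw [graph_hom, ← diagonal_counit', ← cograph_comp, ← cograph_tensor]
  rfl

lemma mul_assoc (X : Lin C) :
    comp (tensor (mul X) (graph (𝟙 X))) (mul X) =
      comp (graph (α_ X X X).hom) (comp (tensor (graph (𝟙 X)) (mul X)) (mul X)) := by
  change comp (tensor (cograph _) (cograph (𝟙 X))) (cograph _) =
    comp _ (comp (tensor (cograph (𝟙 X)) (cograph _)) (cograph _))
  simp only [graph_hom, cograph_tensor, cograph_comp]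
  rw [diagonal_assoc, Category.assoc, Category.assoc, Iso.hom_inv_id, Category.comp_id]

lemma mul_comm (X : Lin C) : comp (graph (β_ X X).hom) (mul X) = mul X := by
  rw [mul, graph_hom, cograph_comp, ← SymmetricCategory.braiding_swap_eq_inv_braiding,
    diagonal_comm]

lemma mul_tensor (X Y : Lin C) :
    mul (X ⊗ Y) = comp (graph (tensorμ X Y X Y)) (tensor (mul X) (mul Y)) := by
  rw [← tensorμIso_hom, graph_hom, mul, mul, mul, cograph_tensor, cograph_comp, tensorμIso_inv,
    diagonal_tensor']

lemma one_tensor (X Y : Lin C) :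
    one (X ⊗ Y) = comp (graph (λ_ (𝟙_ (Lin C))).inv) (tensor (one X) (one Y)) := by
  rw [graph_inv, one, one, one, cograph_tensor, cograph_comp]
  exact congrArg cograph (toUnit_unique _ _)

/-! ### The Frobenius and special laws. -/

lemma frobenius_left (X : Lin C) :
    comp (tensor (comul X) (graph (𝟙 X)))
      (comp (graph (α_ X X X).hom) (tensor (graph (𝟙 X)) (mul X))) = comp (mul X) (comul X) := by
  change comp (tensor (graph _) _) (comp _ (tensor (cograph (𝟙 X)) (cograph _))) = _
  -- The left side collapses to one graph followed by one cograph. Its pullback span has the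
  -- diagonal as both legs, which is also the span of `mul` followed by `comul`.
  rw [graph_tensor, cograph_tensor, ← comp_assoc, graph_comp,
    graph_comp_cograph (isPullback_frobenius_left X)]
  exact (cograph_comp_graph _ _).symm

lemma frobenius_right (X : Lin C) :
    comp (tensor (graph (𝟙 X)) (comul X))
      (comp (graph (α_ X X X).inv) (tensor (mul X) (graph (𝟙 X)))) = comp (mul X) (comul X) := by
  change comp (tensor _ (graph _)) (comp _ (tensor (cograph _) (cograph (𝟙 X)))) = _
  rw [graph_tensor, cograph_tensor, ← comp_assoc, graph_comp,
    graph_comp_cograph (isPullback_frobenius_right X)]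
  exact (cograph_comp_graph _ _).symm

/-- The diagonal is monic, so its kernel pair is trivial. -/
lemma special (X : Lin C) : comp (comul X) (mul X) = graph (𝟙 X) :=
  graph_comp_cograph (isPullback_diagonal X)

end IsoClass

end OpenSystem

open OpenSystem

/-! ### The hypergraph category structure. -/

namespace Dynam

variable [HasFiniteLimits (Lin C)]

noncomputable instance : Category.{max u v} (Dynam C) where
  Hom X Y := IsoClass X.lin Y.lin
  id X := IsoClass.graph (𝟙 X.lin)
  comp := IsoClass.comp
  id_comp := IsoClass.id_comp
  comp_id := IsoClass.comp_id
  assoc := IsoClass.comp_assoc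

/-- An isomorphism of `Lin(C)`, as an isomorphism of `Dynam`. -/
noncomputable def isoOfLin {X Y : Dynam C} (e : X.lin ≅ Y.lin) : X ≅ Y where
  hom := IsoClass.graph e.hom
  inv := IsoClass.graph e.inv
  hom_inv_id := IsoClass.graph_hom_comp_graph_inv e
  inv_hom_id := IsoClass.graph_inv_comp_graph_hom e

noncomputable instance : MonoidalCategoryStruct (Dynam C) where
  tensorObj X Y := ⟨X.obj ⊗ Y.obj⟩
  tensorUnit := ⟨𝟙_ C⟩
  tensorHom := IsoClass.tensor
  whiskerLeft X _ _ f := IsoClass.tensor (IsoClass.graph (𝟙 X.lin)) f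
  whiskerRight f X := IsoClass.tensor f (IsoClass.graph (𝟙 X.lin))
  associator X Y Z := isoOfLin (X := ⟨(X.obj ⊗ Y.obj) ⊗ Z.obj⟩) (Y := ⟨X.obj ⊗ Y.obj ⊗ Z.obj⟩)
    (α_ X.lin Y.lin Z.lin)
  leftUnitor X := isoOfLin (X := ⟨𝟙_ C ⊗ X.obj⟩) (λ_ X.lin)
  rightUnitor X := isoOfLin (X := ⟨X.obj ⊗ 𝟙_ C⟩) (ρ_ X.lin)

noncomputable instance : MonoidalCategory (Dynam C) := .ofTensorHom
  (id_tensorHom_id := fun X Y =>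
    (IsoClass.graph_tensor _ _).trans (congrArg IsoClass.graph (id_tensorHom_id X.lin Y.lin)))
  (id_tensorHom := fun _ _ _ _ => rfl)
  (tensorHom_id := fun _ _ => rfl)
  (tensorHom_comp_tensorHom := IsoClass.tensor_comp_tensor)
  (associator_naturality := IsoClass.associator_naturality)
  (leftUnitor_naturality := IsoClass.leftUnitor_naturality)
  (rightUnitor_naturality := IsoClass.rightUnitor_naturality)
  (pentagon := fun W X Y Z => IsoClass.pentagon W.lin X.lin Y.lin Z.lin)
  (triangle := fun X Y => IsoClass.triangle X.lin Y.lin)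

noncomputable instance : SymmetricCategory (Dynam C) where
  braiding X Y := isoOfLin (X := X ⊗ Y) (Y := Y ⊗ X) (β_ X.lin Y.lin)
  braiding_naturality_right X _ _ f := IsoClass.braiding_naturality (IsoClass.graph (𝟙 X.lin)) f
  braiding_naturality_left f Z := IsoClass.braiding_naturality f (IsoClass.graph (𝟙 Z.lin))
  hexagon_forward X Y Z := IsoClass.hexagon_forward X.lin Y.lin Z.lin
  hexagon_reverse X Y Z := IsoClass.hexagon_reverse X.lin Y.lin Z.lin
  symmetry X Y := IsoClass.symmetry X.lin Y.lin

lemma tensorμ_eq (X X' Y Y' : Dynam C) :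
    tensorμ X X' Y Y' = IsoClass.graph (tensorμ X.lin X'.lin Y.lin Y'.lin) :=
  IsoClass.graph_tensorμ X.lin X'.lin Y.lin Y'.lin

noncomputable instance (X : Dynam C) : ComonObj X where
  counit := IsoClass.counit X.lin
  comul := IsoClass.comul X.lin
  counit_comul := IsoClass.counit_comul X.lin
  comul_counit := IsoClass.comul_counit X.lin
  comul_assoc := IsoClass.comul_assoc X.lin

noncomputable instance : CopyDiscardCategory (Dynam C) where
  isCommComonObj X := ⟨IsoClass.comul_comm X.lin⟩
  copy_tensor X Y := (IsoClass.comul_tensor X.lin Y.lin).trans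
    (congrArg (IsoClass.comp _) (tensorμ_eq X X Y Y).symm)
  discard_tensor X Y := IsoClass.counit_tensor X.lin Y.lin
  copy_unit := IsoClass.comul_unit
  discard_unit := IsoClass.counit_unit

noncomputable instance : HypergraphCategory (Dynam C) where
  monObj X :=
    { one := IsoClass.one X.lin
      mul := IsoClass.mul X.lin
      one_mul := IsoClass.one_mul X.lin
      mul_one := IsoClass.mul_one X.lin
      mul_assoc := IsoClass.mul_assoc X.lin }
  mul_comm X := IsoClass.mul_comm X.lin
  frobenius_left X := IsoClass.frobenius_left X.lin
  frobenius_right X := IsoClass.frobenius_right X.lin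
  special X := IsoClass.special X.lin
  mul_tensor X Y := (IsoClass.mul_tensor X.lin Y.lin).trans
    (congrArg (IsoClass.comp · _) (tensorμ_eq X Y X Y).symm)
  one_tensor X Y := IsoClass.one_tensor X.lin Y.lin
  mul_unit := IsoClass.mul_unit
  one_unit := IsoClass.one_unit

end Dynam

end Dynamics

theorem mainTheorem4 (C : Type u) [Category.{v} C] [CartesianMonoidalCategory C]
    [CartesianReverseDerivative C] [HasFiniteLimits (Dynamics.Lin C)] :
    (∃ (_ : Category.{max u v} (Dynamics.Dynam C)) (_ : MonoidalCategory (Dynamics.Dynam C))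
        (_ : HypergraphCategory (Dynamics.Dynam C)),
      HypergraphData.of (Dynamics.Dynam C) = Dynamics.dynamData C) ∧
    ∀ (X Y Z : Dynamics.Dynam C) (A : Dynamics.OpenSystem X.lin Y.lin)
      (B : Dynamics.OpenSystem Y.lin Z.lin) (s : PullbackCone A.right B.left),
      Nonempty (IsLimit s) →
        (Dynamics.dynamData C).comp (X := X) (Y := Y) (Z := Z) ⟦A⟧ ⟦B⟧ = ⟦A.compose B s⟧ :=
  -- The instances use the prescribed operations, up to unfolding, so the two collections of data
  -- agree by definition.
  ⟨⟨inferInstance, inferInstance, inferInstance, rfl⟩,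
    fun _ _ _ A B _ ⟨hs⟩ => Dynamics.OpenSystem.IsoClass.mk_comp_mk A B hs⟩
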